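/- **Setting.** Let $T,d\in\mathbb N$ and let $\Omega_1,\dots,\Omega_T$ be Polish spaces; put $\Omega^t:=\Omega_1\times\dots\times\Omega_t$ ($\Omega^0$ is a singleton). For a Polish space $E$, $\mathfrak P(E)$ is the set of Borel probability measures on $E$ with the weak topology, and $\mathcal B_c(E)$ is the universal $\sigma$-algebra, i.e. the intersection of the $P$-completions of $\mathcal B(E)$ over all $P\in\mathfrak P(E)$. For $\mathcal R\subset\mathfrak P(E)$, a set $N\subset E$ is $\mathcal R$-polar if it is contained in a Borel set $A$ with $P(A)=0$ for all $P\in\mathcal R$; a property holds $\mathcal R$-q.s. if it holds outside an $\mathcal R$-polar set, and a set is of $\mathcal R$-full measure if its complement is $\mathcal R$-polar. Let $S_t:\Omega^t\to\mathbb R_+^d$ be Borel for $0\le t\le T$, and write $\Delta S_{t+1}(\omega^t,\omega_{t+1})=S_{t+1}(\omega^t,\omega_{t+1})-S_t(\omega^t)$. For $0\le t\le T-1$ and $\omega^t\in\Omega^t$ let $\mathcal Q_{t+1}(\omega^t)\subset\mathfrak P(\Omega_{t+1})$ be non-empty and such that, for $t\ge1$, the graph $\{(\omega^t,P):P\in\mathcal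 Q_{t+1}(\omega^t)\}\subset\Omega^t\times\mathfrak P(\Omega_{t+1})$ is analytic. Let $\mathcal Q^t\subset\mathfrak P(\Omega^t)$ be the set of all $q_1\otimes\dots\otimes q_t$, where each $q_{k+1}:\Omega^k\to\mathfrak P(\Omega_{k+1})$ is a universally measurable stochastic kernel with $q_{k+1}(\cdot,\omega^k)\in\mathcal Q_{k+1}(\omega^k)$ for all $\omega^k\in\Omega^k$ (and $\mathcal Q^0$ consists of the unique probability measure on the singleton $\Omega^0$). For $\omega^t\in\Omega^t$ and $\theta\in\mathbb R^d$ put $$\Pi\mathcal S_t(0)(\omega^t,\theta)=\{x\in\mathbb R:\ x+\theta\,\Delta S_{t+1}(\omega^t,\cdot)\ge0\ \ \mathcal Q_{t+1}(\omega^t)\text{-q.s.}\},\qquad \Pi_t(0)(\omega^t)=\bigcup_{\theta\in\mathbb R^d}\Pi\mathcal S_t(0)(\omega^t,\theta),$$ and $\pi_t(0)(\omega^t)=\inf\Pi_t(0)(\omega^t)\in[-\infty,0]$. The condition $\mathrm{AIP}(\mathcal Q_{t+1}(\omega^t))$ means $\pi_t(0)(\omega^t)=0$. Let $D_t(\omega^t)=\mathrm{supp}_{\mathcal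 Q_{t+1}}\Delta S_{t+1}(\omega^t)$ be the intersection of all closed $F\subset\mathbb R^d$ such that $P(\Delta S_{t+1}(\omega^t,\cdot)\in F)=1$ for all $P\in\mathcal Q_{t+1}(\omega^t)$. The one-step condition $\mathrm{AIP}_t$ means: for every $\mathcal B_c(\Omega^t)$-measurable $\theta:\Omega^t\to\mathbb R^d$ and every $\mathcal B_c(\Omega^t)$-measurable $X:\Omega^t\to\mathbb R$ with $X\le0$ $\mathcal Q^t$-q.s. and $X(\cdot)\in\Pi\mathcal S_t(0)(\cdot,\theta(\cdot))$ on a set of $\mathcal Q^t$-full measure, one has $X=0$ $\mathcal Q^t$-q.s. **Proposition.** Fix $t\in\{0,\dots,T-1\}$. The following are equivalent to $\mathrm{AIP}_t$, each separately: 1. $F^t:=\{\omega^t\in\Omega^t:\mathrm{AIP}(\mathcal Q_{t+1}(\omega^t))\text{ holds}\}$ is of $\mathcal Q^t$-full measure; 2. $\{\omega^t\in\Omega^t:\Pi_t(0)(\omega^t)\cap\mathbb R_-=\{0\}\}$ is of $\mathcal Q^t$-full measure; 3. $\pi_t(0)(\cdot)=0$ $\mathcal Q^t$-q.s.; 4.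 for every $\mathcal B_c(\Omega^t)$-measurable $X:\Omega^t\to\mathbb R$ with $X\le 0$ $\mathcal Q^t$-q.s. and $X(\cdot)\in\Pi_t(0)(\cdot)$ on a set of $\mathcal Q^t$-full measure, one has $X=0$ $\mathcal Q^t$-q.s.; 5. $0\in\overline{\mathrm{conv}}\,D_t(\cdot)$ $\mathcal Q^t$-q.s., where $\overline{\mathrm{conv}}$ is the closed convex hull. Moreover, if $0\in\mathrm{conv}\,D_t(\cdot)$ $\mathcal Q^t$-q.s. (convex hull without closure), then $\mathrm{AIP}_t$ holds; and if $\mathrm{conv}\,D_t(\cdot)$ is closed $\mathcal Q^t$-q.s., then $\mathrm{AIP}_t$ is equivalent to $0\in\mathrm{conv}\,D_t(\cdot)$ $\mathcal Q^t$-q.s. Finally, $F^t$ is an analytic subset of $\Omega^t$. -/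

import Mathlib

open MeasureTheory Set
open scoped ENNReal

/-! ### Universally measurable sets and quasi-sure notions -/

/-- The universal sigma-algebra of `E`: the sets that belong to the completion of the given
sigma-algebra with respect to every probability measure. -/
@[reducible] def universalSigma (E : Type*) [MeasurableSpace E] : MeasurableSpace E where
  MeasurableSet' s := ∀ P : ProbabilityMeasure E, NullMeasurableSet s (P : Measure E)
  measurableSet_empty _ := MeasurableSet.empty.nullMeasurableSet
  measurableSet_compl _ h P := (h P).compl
  measurableSet_iUnion _ h P := NullMeasurableSet.iUnion fun i => h i P

/-- Universally measurable maps. -/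
def UnivMeasurable {E F : Type*} [MeasurableSpace E] [MeasurableSpace F] (f : E → F) : Prop :=
  @Measurable E F (universalSigma E) _ f

/-- `N` is polar for the family `ℛ`: it is included in a measurable set that is null for every
`P ∈ ℛ`. -/
def IsPolar {E : Type*} [MeasurableSpace E] (ℛ : Set (ProbabilityMeasure E)) (N : Set E) : Prop :=
  ∃ A : Set E, MeasurableSet A ∧ N ⊆ A ∧ ∀ P ∈ ℛ, (P : Measure E) A = 0

/-- The property `p` holds `ℛ`-quasi-surely. -/
def QuasiSurely {E : Type*} [MeasurableSpace E] (ℛ : Set (ProbabilityMeasure E))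
    (p : E → Prop) : Prop :=
  IsPolar ℛ {x | ¬ p x}

/-- The set `A` is of `ℛ`-full measure. -/
def IsFullMeasure {E : Type*} [MeasurableSpace E] (ℛ : Set (ProbabilityMeasure E))
    (A : Set E) : Prop :=
  IsPolar ℛ Aᶜ

/-- The quasi-sure support of `X` under the family `ℛ`. -/
def qsSupport {E : Type*} [MeasurableSpace E] {d : ℕ} (ℛ : Set (ProbabilityMeasure E))
    (X : E → EuclideanSpace ℝ (Fin d)) : Set (EuclideanSpace ℝ (Fin d)) :=
  ⋂₀ {F | IsClosed F ∧ ∀ P ∈ ℛ, (P : Measure E) (X ⁻¹' F) = 1}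

/-! ### One-period super-hedging, at a fixed state of the world -/

/-- Initial values `x` such that the strategy `θ` started from `x` super-hedges the claim `Z`,
when the price increment is `ΔY` and the set of priors is `ℛ`. -/
def hedgePricesWith {E : Type*} [MeasurableSpace E] {d : ℕ} (ℛ : Set (ProbabilityMeasure E))
    (ΔY : E → EuclideanSpace ℝ (Fin d)) (Z : E → ℝ) (θ : EuclideanSpace ℝ (Fin d)) : Set ℝ :=
  {x | QuasiSurely ℛ fun e => Z e ≤ x + inner ℝ θ (ΔY e)}

/-- The set of super-hedging prices of the claim `Z`. -/
def hedgePrices {E : Type*} [MeasurableSpace E] {d : ℕ} (ℛ : Set (ProbabilityMeasure E))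
    (ΔY : E → EuclideanSpace ℝ (Fin d)) (Z : E → ℝ) : Set ℝ :=
  {x | ∃ θ : EuclideanSpace ℝ (Fin d), QuasiSurely ℛ fun e => Z e ≤ x + inner ℝ θ (ΔY e)}

/-- The infimum super-hedging cost of the claim `Z`, an extended real number. -/
noncomputable def hedgeCost {E : Type*} [MeasurableSpace E] {d : ℕ}
    (ℛ : Set (ProbabilityMeasure E)) (ΔY : E → EuclideanSpace ℝ (Fin d)) (Z : E → ℝ) : EReal :=
  sInf ((fun x : ℝ => (x : EReal)) '' hedgePrices ℛ ΔY Z)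

/-- Absence of Instantaneous Profit at a fixed state: the infimum super-hedging cost of the
claim `0` is equal to `0`. -/
def AIPAt {E : Type*} [MeasurableSpace E] {d : ℕ} (ℛ : Set (ProbabilityMeasure E))
    (ΔY : E → EuclideanSpace ℝ (Fin d)) : Prop :=
  hedgeCost ℛ ΔY (fun _ => 0) = 0

/-! ### The multi-period model

`Ω k` is the space in which the uncertainty between times `k` and `k + 1` is resolved (the paths
are indexed from `0`, so `Ω k` is the `(k+1)`-st factor).  Only the factors `Ω k` with `k < T`
matter for a model with horizon `T`. -/

/-- The space of histories up to time `t`, i.e. `Ω 0 × ⋯ × Ω (t - 1)`; a single point for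
`t = 0`. -/
abbrev Hist (Ω : ℕ → Type*) (t : ℕ) : Type _ := (i : Fin t) → Ω i

/-- The history `(ω, ω')` obtained by appending `ω'` to `ω`. -/
def Hist.snoc {Ω : ℕ → Type*} {t : ℕ} (ω : Hist Ω t) (ω' : Ω t) : Hist Ω (t + 1) :=
  Fin.snoc (α := fun i : Fin (t + 1) => Ω i) ω ω'

/-- The price increment between times `t` and `t + 1`, given the history up to time `t`. -/
def priceIncrement {Ω : ℕ → Type*} {d : ℕ}
    (S : (t : ℕ) → Hist Ω t → EuclideanSpace ℝ (Fin d)) (t : ℕ) (ω : Hist Ω t) (ω' : Ω t) :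
    EuclideanSpace ℝ (Fin d) :=
  S (t + 1) (ω.snoc ω') - S t ω

/-- The graph of a set-valued map with values in the probability measures. -/
def priorGraph {E F : Type*} [MeasurableSpace F] (𝒬 : E → Set (ProbabilityMeasure F)) :
    Set (E × ProbabilityMeasure F) :=
  {p | p.2 ∈ 𝒬 p.1}

/-- `R = P ⊗ q`: the law `R` on histories up to time `t + 1` is the composition of the law `P` on
histories up to time `t` with the kernel `q`. -/
def IsComposition {Ω : ℕ → Type*} [∀ i, MeasurableSpace (Ω i)] {t : ℕ}
    (P : ProbabilityMeasure (Hist Ω t)) (q : Hist Ω t → ProbabilityMeasure (Ω t))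
    (R : ProbabilityMeasure (Hist Ω (t + 1))) : Prop :=
  ∀ A : Set (Hist Ω (t + 1)), MeasurableSet A →
    (R : Measure (Hist Ω (t + 1))) A =
      ∫⁻ ω, (q ω : Measure (Ω t)) {ω' | ω.snoc ω' ∈ A} ∂(P : Measure (Hist Ω t))

/-- The set of priors on histories up to time `t`: all the laws `q 0 ⊗ ⋯ ⊗ q (t - 1)`, where each
`q k` is a universally measurable stochastic kernel with `q k ω ∈ 𝒬 k ω` for every history `ω`.
The sigma-algebra on `ProbabilityMeasure` is the one generated by the evaluations, i.e. the Borel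
sigma-algebra of the weak topology.  For `t = 0` it consists of the unique probability
measure on a one-point space. -/
def priors {Ω : ℕ → Type*} [∀ i, MeasurableSpace (Ω i)]
    (𝒬 : (t : ℕ) → Hist Ω t → Set (ProbabilityMeasure (Ω t))) :
    (t : ℕ) → Set (ProbabilityMeasure (Hist Ω t))
  | 0 => Set.univ
  | t + 1 => {R | ∃ P ∈ priors 𝒬 t, ∃ q : Hist Ω t → ProbabilityMeasure (Ω t),
      UnivMeasurable q ∧ (∀ ω, q ω ∈ 𝒬 t ω) ∧ IsComposition P q R}

/-- The one-step condition `AIP_t`. -/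
def OneStepAIP {Ω : ℕ → Type*} [∀ i, MeasurableSpace (Ω i)] {d : ℕ}
    (S : (t : ℕ) → Hist Ω t → EuclideanSpace ℝ (Fin d))
    (𝒬 : (t : ℕ) → Hist Ω t → Set (ProbabilityMeasure (Ω t))) (t : ℕ) : Prop :=
  ∀ θ : Hist Ω t → EuclideanSpace ℝ (Fin d), UnivMeasurable θ →
    ∀ X : Hist Ω t → ℝ, UnivMeasurable X →
      QuasiSurely (priors 𝒬 t) (fun ω => X ω ≤ 0) →
      IsFullMeasure (priors 𝒬 t)
        {ω | X ω ∈ hedgePricesWith (𝒬 t ω) (priceIncrement S t ω) (fun _ => 0) (θ ω)} →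
      QuasiSurely (priors 𝒬 t) (fun ω => X ω = 0)

/-! Fix a state and let `D` be the quasi-sure support of the price increment. The set `{y | 0 ≤ x +
⟨θ, y⟩}` is closed, so `x` and `θ` super-hedge `0` exactly when this set contains `D`. By
Hahn–Banach a negative price exists iff `0` can be strictly separated from `D`, that is iff `0` is
outside the closed convex hull (`aipAt_iff_zero_mem_closure_convexHull`). This settles everything
that is decided state by state, and it shows that AIP at quasi-every state implies `OneStepAIP`.

The converse needs a universally measurable strategy that realizes the profit. Let `p ω` be the
projection of `0` on the closed convex hull of `D ω`. Since `⟨p, y⟩ ≥ ‖p‖ ^ 2` on `D`, the strategy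
`p / ‖p‖ ^ 2` super-hedges `0` from `-1` wherever `p ≠ 0`, so `OneStepAIP` forces `p = 0`
quasi-surely.

Measurability of `p` comes from hitting sets: `D ω` meets an open set iff some prior charges it,
which is an analytic condition on `ω` because the prior graph is analytic. It passes to convex hulls
by countable approximation, and analytic sets are universally measurable. The analyticity of the set
of AIP states follows from the same hitting sets. -/

/-! ### Universal measurability of analytic sets -/

/-- The sequences bounded by `b` along the first `n` coordinates are eventually contained in any
open set that contains all sequences bounded by `b`. -/
theorem exists_initial_bound_subset (b : ℕ → ℕ) {V : Set (ℕ → ℕ)} (hV : IsOpen V)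
    (hbV : {x | ∀ i, x i ≤ b i} ⊆ V) : ∃ n, {x : ℕ → ℕ | ∀ i < n, x i ≤ b i} ⊆ V := by
  by_contra! H
  simp only [not_subset] at H
  choose x hx hxV using H
  have hK : IsCompact {x : ℕ → ℕ | ∀ i, x i ≤ b i} := by
    have h := isCompact_univ_pi (X := fun _ : ℕ => ℕ) (s := fun i => Iic (b i))
      fun i => (finite_Iic (b i)).isCompact
    convert h using 1
    ext x
    simp [Pi.le_def]
  -- Truncating at `b` brings the sequences into the compact box and leaves the first `n`
  -- coordinates of `x n` unchanged, so the limit along `φ` is the same.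
  obtain ⟨y, hy, φ, hφ, hlim⟩ := hK.tendsto_subseq (x := fun n i => min (x n i) (b i))
    fun n i => min_le_right _ _
  have hlim' : Filter.Tendsto (x ∘ φ) Filter.atTop (nhds y) := by
    rw [tendsto_pi_nhds] at hlim ⊢
    intro i
    refine (hlim i).congr' ?_
    filter_upwards [Filter.eventually_gt_atTop i] with n hn
    exact min_eq_left (hx (φ n) i (hn.trans_le hφ.le_apply))
  obtain ⟨n, hn⟩ := (hlim'.eventually (hV.mem_nhds (hbV hy))).exists
  exact hxV _ hn

/-- Inner approximation of the outer measure of an analytic set by compact sets. -/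
theorem exists_isCompact_le_measure_of_lt {E : Type*} [TopologicalSpace E] [MeasurableSpace E]
    (μ : Measure E) [μ.OuterRegular] {f : (ℕ → ℕ) → E} (hf : Continuous f) {c : ℝ≥0∞}
    (hc : c < μ (range f)) : ∃ K ⊆ range f, IsCompact K ∧ c ≤ μ K := by
  let B : (ℕ → ℕ) → ℕ → Set (ℕ → ℕ) := fun b n => {x | ∀ i < n, x i ≤ b i}
  have step : ∀ (n : ℕ) (b : ℕ → ℕ), c < μ (f '' B b n) →
      ∃ m, c < μ (f '' B (Function.update b n m) (n + 1)) := by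
    intro n b h
    have hU : f '' B b n = ⋃ m, f '' B (Function.update b n m) (n + 1) := by
      rw [← image_iUnion]
      congr 1
      ext x
      simp only [B, mem_ofPred_eq, mem_iUnion]
      constructor
      · intro hx
        refine ⟨x n, fun i hi => ?_⟩
        rcases Nat.lt_succ_iff_lt_or_eq.1 hi with h | rfl
        · rw [Function.update_of_ne h.ne]; exact hx i h
        · simp
      · rintro ⟨m, hm⟩ i hi
        have := hm i (hi.trans (Nat.lt_succ_self n))
        rwa [Function.update_of_ne hi.ne] at this
    have hmono : Monotone fun m => f '' B (Function.update b n m) (n + 1) := by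
      intro m m' hm
      refine image_mono fun x hx i hi => (hx i hi).trans ?_
      exact update_le_update_iff.2 ⟨hm, fun _ _ => le_rfl⟩ i
    -- Continuity from below holds for increasing sequences of arbitrary sets, so the images need
    -- not be measurable.
    rw [hU, hmono.measure_iUnion, lt_iSup_iff] at h
    exact h
  let F : (n : ℕ) → {b : ℕ → ℕ // c < μ (f '' B b n)} := fun n =>
    Nat.rec ⟨0, by simpa [B] using hc⟩
      (fun k b => ⟨Function.update b.1 k (step k b.1 b.2).choose, (step k b.1 b.2).choose_spec⟩) n
  have hF : ∀ n, ∃ m, (F (n + 1)).1 = Function.update (F n).1 n m := fun n => ⟨_, rfl⟩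
  have hstab : ∀ n k i, i < n → (F (n + k)).1 i = (F n).1 i := by
    intro n k i hi
    induction k with
    | zero => rfl
    | succ k ih =>
      obtain ⟨m, hm⟩ := hF (n + k)
      rw [← add_assoc, hm, Function.update_of_ne (by omega), ih]
  -- Coordinate `i` is set in passing from stage `i` to stage `i + 1` and never changes afterwards.
  let b : ℕ → ℕ := fun i => (F (i + 1)).1 i
  have hb : ∀ n, c < μ (f '' B b n) := by
    intro n
    have : B b n = B (F n).1 n := by
      ext x
      refine forall₂_congr fun i hi => ?_
      obtain ⟨k, rfl⟩ := Nat.exists_eq_add_of_le (Nat.succ_le_of_lt hi)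
      rw [hstab (i + 1) k i (Nat.lt_succ_self i)]
    rw [this]
    exact (F n).2
  have hK : IsCompact {x : ℕ → ℕ | ∀ i, x i ≤ b i} := by
    have h := isCompact_univ_pi (X := fun _ : ℕ => ℕ) (s := fun i => Iic (b i))
      fun i => (finite_Iic (b i)).isCompact
    convert h using 1
    ext x
    simp [Pi.le_def]
  refine ⟨f '' {x | ∀ i, x i ≤ b i}, image_subset_range _ _, hK.image hf, ?_⟩
  rw [Set.measure_eq_iInf_isOpen]
  refine le_iInf₂ fun U hU => le_iInf fun hUo => ?_
  obtain ⟨n, hn⟩ := exists_initial_bound_subset b (hUo.preimage hf) (image_subset_iff.1 hU)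
  exact (hb n).le.trans (measure_mono (image_subset_iff.2 hn))

/-- Compact subsets whose measures approach the outer measure of the set have a Borel union that
exhausts it up to a null set. -/
theorem MeasureTheory.AnalyticSet.nullMeasurableSet {E : Type*} [TopologicalSpace E] [T2Space E]
    [MeasurableSpace E] [OpensMeasurableSpace E] {s : Set E} (hs : AnalyticSet s) (μ : Measure E)
    [IsFiniteMeasure μ] [μ.OuterRegular] : NullMeasurableSet s μ := by
  rw [AnalyticSet] at hs
  rcases hs with rfl | ⟨f, hf, rfl⟩
  · exact nullMeasurableSet_empty
  rcases eq_or_ne (μ (range f)) 0 with h0 | h0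
  · exact NullMeasurableSet.of_null h0
  obtain ⟨u, -, hu, hlim⟩ := exists_seq_strictMono_tendsto' (pos_iff_ne_zero.2 h0)
  choose K hKs hK hKu using fun n => exists_isCompact_le_measure_of_lt μ hf (hu n).2
  have hm : MeasurableSet (⋃ n, K n) := .iUnion fun n => (hK n).measurableSet
  refine (hm.nullMeasurableSet).congr
    (ae_eq_of_subset_of_measure_ge (iUnion_subset hKs) ?_ hm.nullMeasurableSet (measure_ne_top _ _))
  exact le_of_tendsto' hlim fun n => (hKu n).trans (measure_mono (subset_iUnion K n))

theorem MeasureTheory.AnalyticSet.measurableSet_universalSigma {E : Type*} [TopologicalSpace E]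
    [PolishSpace E] [MeasurableSpace E] [BorelSpace E] {s : Set E} (hs : AnalyticSet s) :
    MeasurableSet[universalSigma E] s := by
  let := TopologicalSpace.upgradeIsCompletelyMetrizable E
  exact fun P => hs.nullMeasurableSet (P : Measure E)

/-! ### Hitting sets of a family of priors with analytic graph -/

/-- Open sets form a generating π-system, and on them the mass is lower semicontinuous by the
portmanteau theorem. -/
theorem ProbabilityMeasure.measurable_coe_of_continuous {X F : Type*} [TopologicalSpace X]
    [MeasurableSpace X] [OpensMeasurableSpace X] [TopologicalSpace F] [PolishSpace F]
    [MeasurableSpace F] [BorelSpace F] {g : X → ProbabilityMeasure F} (hg : Continuous g) :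
    Measurable fun x => (g x : Measure F) := by
  let := TopologicalSpace.upgradeIsCompletelyMetrizable F
  refine Measurable.measure_of_isPiSystem_of_isProbabilityMeasure
    (BorelSpace.measurable_eq (α := F)) isPiSystem_isOpen fun U hU => ?_
  refine LowerSemicontinuous.measurable (lowerSemicontinuous_iff_le_liminf.2 fun x => ?_)
  exact ProbabilityMeasure.le_liminf_measure_open_of_tendsto hg.continuousAt hU

theorem analyticSet_exists_prior_ne_zero {E F : Type*} [TopologicalSpace E] [PolishSpace E]
    [MeasurableSpace E] [BorelSpace E] [TopologicalSpace F] [PolishSpace F] [MeasurableSpace F]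
    [BorelSpace F] {𝒬 : E → Set (ProbabilityMeasure F)} (h𝒬 : AnalyticSet (priorGraph 𝒬))
    {s : Set (E × F)} (hs : MeasurableSet s) :
    AnalyticSet {ω | ∃ P ∈ 𝒬 ω, (P : Measure F) (Prod.mk ω ⁻¹' s) ≠ 0} := by
  rw [AnalyticSet] at h𝒬
  rcases h𝒬 with h | ⟨g, hg, hgr⟩
  · convert analyticSet_empty
    refine eq_empty_of_forall_notMem fun ω hω => ?_
    obtain ⟨P, hP, -⟩ := hω
    exact (h ▸ (show (ω, P) ∈ priorGraph 𝒬 from hP) : (ω, P) ∈ (∅ : Set _))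
  -- Parametrizing the graph by Baire space turns the priors into a kernel. The condition on the
  -- parameter is then Borel, and the wanted set is its continuous image under the first coordinate
  -- of `g`.
  let κ : ProbabilityTheory.Kernel (ℕ → ℕ) F :=
    ⟨fun x => ((g x).2 : Measure F),
      ProbabilityMeasure.measurable_coe_of_continuous (continuous_snd.comp hg)⟩
  have : ProbabilityTheory.IsMarkovKernel κ := ⟨fun x => (g x).2.2⟩
  have hg1 : Measurable fun x => (g x).1 := (continuous_fst.comp hg).measurable
  have hm : Measurable fun x => κ x (Prod.mk (g x).1 ⁻¹' s) :=
    ProbabilityTheory.Kernel.measurable_kernel_prodMk_left (κ := κ)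
      (((hg1.comp measurable_fst).prodMk measurable_snd) hs)
  have hM : MeasurableSet {x | κ x (Prod.mk (g x).1 ⁻¹' s) ≠ 0} :=
    (hm (measurableSet_singleton 0)).compl
  convert hM.analyticSet.image_of_continuous (continuous_fst.comp hg) using 1
  ext ω
  constructor
  · rintro ⟨P, hP, h0⟩
    obtain ⟨x, hx⟩ : (ω, P) ∈ range g := hgr ▸ hP
    refine ⟨x, ?_, by simp [hx]⟩
    simpa [κ, hx] using h0
  · rintro ⟨x, hx, rfl⟩
    have : g x ∈ priorGraph 𝒬 := hgr ▸ mem_range_self x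
    exact ⟨(g x).2, this, hx⟩

/-! ### The quasi-sure support -/

section Support

variable {F : Type*} [MeasurableSpace F] {d : ℕ} {ℛ : Set (ProbabilityMeasure F)}
  {Y : F → EuclideanSpace ℝ (Fin d)}

theorem isClosed_qsSupport : IsClosed (qsSupport ℛ Y) :=
  isClosed_sInter fun _ h => h.1

/-- The support is an intersection of possibly uncountably many closed sets; the Lindelöf property
reduces it to a countable one. -/
theorem measure_preimage_compl_qsSupport (hY : Measurable Y) {P : ProbabilityMeasure F}
    (hP : P ∈ ℛ) : (P : Measure F) (Y ⁻¹' (qsSupport ℛ Y)ᶜ) = 0 := by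
  obtain ⟨𝒞, h𝒞, h𝒞c, hU⟩ := TopologicalSpace.isOpen_sUnion_countable
    (compl '' {C : Set (EuclideanSpace ℝ (Fin d)) | IsClosed C ∧
      ∀ P ∈ ℛ, (P : Measure F) (Y ⁻¹' C) = 1})
    (by rintro _ ⟨C, hC, rfl⟩; exact hC.1.isOpen_compl)
  rw [qsSupport, compl_sInter, ← hU, sUnion_eq_biUnion, preimage_iUnion₂]
  refine (measure_biUnion_null_iff h𝒞).2 fun V hV => ?_
  obtain ⟨C, hC, rfl⟩ := h𝒞c hV
  rw [preimage_compl, prob_compl_eq_zero_iff (hY hC.1.measurableSet)]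
  exact hC.2 P hP

theorem qsSupport_inter_nonempty_iff (hY : Measurable Y) {U : Set (EuclideanSpace ℝ (Fin d))}
    (hU : IsOpen U) :
    (qsSupport ℛ Y ∩ U).Nonempty ↔ ∃ P ∈ ℛ, (P : Measure F) (Y ⁻¹' U) ≠ 0 := by
  constructor
  · rintro ⟨y, hy, hyU⟩
    by_contra! H
    refine hy Uᶜ ⟨hU.isClosed_compl, fun P hP => ?_⟩ hyU
    rw [preimage_compl, prob_compl_eq_one_iff (hY hU.measurableSet)]
    exact H P hP
  · rintro ⟨P, hP, h⟩
    by_contra hne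
    refine h (measure_mono_null (preimage_mono ?_) (measure_preimage_compl_qsSupport hY hP))
    exact fun y hy hyD => hne ⟨y, hyD, hy⟩

theorem qsSupport_nonempty (hY : Measurable Y) (hℛ : ℛ.Nonempty) : (qsSupport ℛ Y).Nonempty := by
  obtain ⟨P, hP⟩ := hℛ
  simpa using (qsSupport_inter_nonempty_iff (ℛ := ℛ) hY isOpen_univ).2 ⟨P, hP, by simp⟩

theorem quasiSurely_of_forall_mem_qsSupport (hY : Measurable Y)
    {p : EuclideanSpace ℝ (Fin d) → Prop} (h : ∀ y ∈ qsSupport ℛ Y, p y) :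
    QuasiSurely ℛ fun e => p (Y e) :=
  ⟨Y ⁻¹' (qsSupport ℛ Y)ᶜ, hY isClosed_qsSupport.isOpen_compl.measurableSet,
    fun _ he hmem => he (h _ hmem), fun _ hP => measure_preimage_compl_qsSupport hY hP⟩

theorem forall_mem_qsSupport_of_quasiSurely {p : EuclideanSpace ℝ (Fin d) → Prop}
    (hp : IsClosed {y | p y}) (h : QuasiSurely ℛ fun e => p (Y e)) :
    ∀ y ∈ qsSupport ℛ Y, p y := by
  obtain ⟨A, hA, hsub, h0⟩ := h
  refine fun y hy => hy _ ⟨hp, fun P hP => le_antisymm prob_le_one ?_⟩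
  rw [← (prob_compl_eq_one_iff hA).2 (h0 P hP)]
  exact measure_mono fun e he => by_contra fun hn => he (hsub hn)

/-! ### Instantaneous profit at a fixed state -/

theorem zero_mem_hedgePrices : (0 : ℝ) ∈ hedgePrices ℛ Y (fun _ => 0) :=
  ⟨0, ∅, .empty, by simp, by simp⟩

theorem aipAt_iff_forall_nonneg :
    AIPAt ℛ Y ↔ ∀ x ∈ hedgePrices ℛ Y (fun _ => 0), 0 ≤ x := by
  rw [AIPAt, hedgeCost]
  constructor
  · intro h x hx
    have := sInf_le (mem_image_of_mem (fun x : ℝ => (x : EReal)) hx)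
    rw [h] at this
    exact_mod_cast this
  · intro h
    refine le_antisymm (sInf_le ⟨0, zero_mem_hedgePrices, rfl⟩) (le_sInf ?_)
    rintro _ ⟨x, hx, rfl⟩
    exact EReal.coe_nonneg.2 (h x hx)

theorem aipAt_iff_inter_Iic_eq :
    AIPAt ℛ Y ↔ hedgePrices ℛ Y (fun _ => 0) ∩ Iic 0 = {0} := by
  rw [aipAt_iff_forall_nonneg]
  constructor
  · intro h
    refine Subset.antisymm (fun x hx => le_antisymm hx.2 (h x hx.1)) ?_
    rintro _ rfl
    exact ⟨zero_mem_hedgePrices, self_mem_Iic⟩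
  · intro h x hx
    by_contra! hneg
    have : x ∈ ({0} : Set ℝ) := h ▸ ⟨hx, hneg.le⟩
    exact hneg.ne this

theorem aipAt_iff_zero_mem_closure_convexHull (hY : Measurable Y) :
    AIPAt ℛ Y ↔ 0 ∈ closure (convexHull ℝ (qsSupport ℛ Y)) := by
  rw [aipAt_iff_forall_nonneg]
  constructor
  · intro h
    by_contra h0
    obtain ⟨f, u, hu0, hu⟩ := geometric_hahn_banach_point_closed
      (convex_convexHull ℝ (qsSupport ℛ Y)).closure isClosed_closure h0
    rw [map_zero] at hu0
    have : -u ∈ hedgePrices ℛ Y (fun _ => 0) := by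
      refine ⟨(InnerProductSpace.toDual ℝ _).symm f, ?_⟩
      refine quasiSurely_of_forall_mem_qsSupport
        (p := fun y => 0 ≤ -u + inner ℝ ((InnerProductSpace.toDual ℝ _).symm f) y) hY fun y hy => ?_
      rw [InnerProductSpace.toDual_symm_apply]
      linarith [hu y (subset_closure (subset_convexHull ℝ _ hy))]
    linarith [h _ this]
  · rintro h0 x ⟨θ, hθ⟩
    have hD := forall_mem_qsSupport_of_quasiSurely (p := fun y => 0 ≤ x + inner ℝ θ y)
      (isClosed_le continuous_const (by fun_prop)) hθ
    have hcl : closure (convexHull ℝ (qsSupport ℛ Y)) ⊆ {y | -x ≤ inner ℝ θ y} := by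
      refine closure_minimal (convexHull_min (fun y hy => ?_) ?_)
        (isClosed_le continuous_const (by fun_prop))
      · have := hD y hy
        simp only [mem_ofPred_eq]
        linarith
      · exact convex_halfSpace_ge (innerSL ℝ θ).toLinearMap.isLinear _
    have := hcl h0
    simp only [mem_ofPred_eq, inner_zero_right] at this
    linarith

end Support

/-! ### Convex hulls meeting a ball -/

open scoped Pointwise in
-- The convex hull commutes with Minkowski sums, and the ball is its own hull.
theorem convexHull_subset_add_ball {V : Type*} [NormedAddCommGroup V] [NormedSpace ℝ V]
    {s D : Set V} {ε : ℝ} (h : ∀ z ∈ s, (D ∩ Metric.ball z ε).Nonempty) :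
    convexHull ℝ s ⊆ convexHull ℝ D + Metric.ball 0 ε := by
  rw [← (convex_ball (0 : V) ε).convexHull_eq, ← convexHull_add]
  refine convexHull_mono fun z hz => ?_
  obtain ⟨w, hw, hwz⟩ := h z hz
  refine ⟨w, hw, z - w, ?_, by simp⟩
  rwa [mem_ball_zero_iff, ← dist_eq_norm, dist_comm]

/-- A point of the hull uses finitely many points of `D`, each of which can be moved to the dense
sequence at a cost below `1 / (n + 1)`. On the right, `D` enters only through the balls that it
meets, and all choices are countable. -/
theorem convexHull_inter_ball_nonempty_iff {V : Type*} [NormedAddCommGroup V] [NormedSpace ℝ V]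
    {Z : ℕ → V} (hZ : DenseRange Z) (D : Set V) (q : V) (r : ℝ) :
    (convexHull ℝ D ∩ Metric.ball q r).Nonempty ↔
      ∃ (n : ℕ) (s : Finset ℕ),
        (convexHull ℝ (Z '' s) ∩ Metric.ball q (r - 1 / (n + 1))).Nonempty ∧
        ∀ k ∈ s, (D ∩ Metric.ball (Z k) (1 / (n + 1))).Nonempty := by
  constructor
  · rintro ⟨y, hy, hyr⟩
    rw [Metric.mem_ball] at hyr
    -- Half of the slack pays for moving `y` to `z`, the other half for the smaller radius.
    obtain ⟨n, hn⟩ := exists_nat_one_div_lt (half_pos (sub_pos.2 hyr))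
    have hε : (0 : ℝ) < 1 / (n + 1) := Nat.one_div_pos_of_nat
    rw [convexHull_eq_union_convexHull_finite_subsets] at hy
    simp only [mem_iUnion] at hy
    obtain ⟨t, htD, hyt⟩ := hy
    choose f hf using fun w => hZ.exists_dist_lt w hε
    classical
    obtain ⟨z, hz, e, he, rfl⟩ := convexHull_subset_add_ball (D := Z '' (t.image f))
      (ε := 1 / ((n : ℝ) + 1)) (s := (t : Set V))
      (fun w hw => ⟨Z (f w), ⟨f w, by simpa using ⟨w, hw, rfl⟩, rfl⟩, by
        rw [Metric.mem_ball, dist_comm]; exact hf w⟩) hyt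
    refine ⟨n, t.image f, ⟨z, hz, ?_⟩, fun k hk => ?_⟩
    · rw [Metric.mem_ball]
      rw [mem_ball_zero_iff] at he
      have h1 : dist z q ≤ dist z (z + e) + dist (z + e) q := dist_triangle _ _ _
      have h2 : dist z (z + e) = ‖e‖ := by simp
      linarith
    · obtain ⟨w, hw, rfl⟩ := Finset.mem_image.1 hk
      exact ⟨w, htD hw, hf w⟩
  · rintro ⟨n, s, ⟨y, hy, hyr⟩, hs⟩
    obtain ⟨w, hw, e, he, rfl⟩ := convexHull_subset_add_ball (D := D)
      (ε := 1 / ((n : ℝ) + 1)) (s := Z '' s) (by rintro _ ⟨k, hk, rfl⟩; exact hs k hk) hy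
    refine ⟨w, hw, ?_⟩
    rw [Metric.mem_ball] at hyr ⊢
    rw [mem_ball_zero_iff] at he
    have h1 : dist w q ≤ dist w (w + e) + dist (w + e) q := dist_triangle _ _ _
    have h2 : dist w (w + e) = ‖e‖ := by simp
    linarith

theorem analyticSet_convexHull_inter_ball_nonempty {E V : Type*} [TopologicalSpace E] [T2Space E]
    [NormedAddCommGroup V] [NormedSpace ℝ V] [TopologicalSpace.SeparableSpace V] {D : E → Set V}
    (hD : ∀ z r, AnalyticSet {ω | (D ω ∩ Metric.ball z r).Nonempty}) (q : V) (r : ℝ) :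
    AnalyticSet {ω | (convexHull ℝ (D ω) ∩ Metric.ball q r).Nonempty} := by
  obtain ⟨Z, hZ⟩ := TopologicalSpace.exists_dense_seq V
  have : {ω | (convexHull ℝ (D ω) ∩ Metric.ball q r).Nonempty} =
      ⋃ n : ℕ, ⋃ s : {s : Finset ℕ //
        (convexHull ℝ (Z '' s) ∩ Metric.ball q (r - 1 / (n + 1))).Nonempty},
        ⋂ k : {k // k ∈ s.1}, {ω | (D ω ∩ Metric.ball (Z k) (1 / (n + 1))).Nonempty} := by
    ext ω
    rw [mem_ofPred_eq, convexHull_inter_ball_nonempty_iff hZ]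
    simp only [mem_ofPred_eq, mem_iUnion, mem_iInter, Subtype.exists, Subtype.forall, exists_prop]
  rw [this]
  refine .iUnion fun n => .iUnion fun s => ?_
  -- An empty intersection would be the whole of `E`, which need not be analytic here.
  have : Nonempty {k // k ∈ s.1} := by
    obtain ⟨y, hy, -⟩ := s.2
    obtain ⟨_, k, hk, -⟩ := convexHull_nonempty_iff.1 ⟨y, hy⟩
    exact ⟨⟨k, hk⟩⟩
  exact .iInter fun k => hD _ _

/-! ### Measurable selection of the point of least norm -/

/-- The norm of the minimizer is measurable because `‖p ω‖ < r` iff `K ω` meets the ball of radius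
`r` at `0`. Near-minimizers are close to the minimizer, since `‖y - p‖ ^ 2 ≤ ‖y‖ ^ 2 - ‖p‖ ^ 2` on
`K`; hence `p` is a limit of measurable choices from a dense sequence. -/
theorem exists_measurable_minimal_norm {M V : Type*} [MeasurableSpace M] [NormedAddCommGroup V]
    [InnerProductSpace ℝ V] [CompleteSpace V] [SecondCountableTopology V] [MeasurableSpace V]
    [BorelSpace V] {K : M → Set V} (hne : ∀ ω, (K ω).Nonempty) (hconv : ∀ ω, Convex ℝ (K ω))
    (hK : ∀ q r, MeasurableSet {ω | (K ω ∩ Metric.ball q r).Nonempty}) :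
    ∃ p : M → V, Measurable p ∧ ∀ ω, p ω ∈ closure (K ω) ∧
      ∀ y ∈ K ω, ‖p ω‖ ^ 2 ≤ inner ℝ (p ω) y := by
  have hex : ∀ ω, ∃ v ∈ closure (K ω), ∀ y ∈ K ω, ‖v‖ ^ 2 ≤ inner ℝ v y := by
    intro ω
    obtain ⟨v, hv, hmin⟩ := exists_norm_eq_iInf_of_complete_convex (hne ω).closure
      isClosed_closure.isComplete (hconv ω).closure 0
    rw [norm_eq_iInf_iff_real_inner_le_zero (hconv ω).closure hv] at hmin
    refine ⟨v, hv, fun y hy => ?_⟩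
    have := hmin y (subset_closure hy)
    rw [zero_sub, inner_neg_left, inner_sub_right, real_inner_self_eq_norm_sq] at this
    linarith
  choose p hp hmin using hex
  refine ⟨p, ?_, fun ω => ⟨hp ω, hmin ω⟩⟩
  have hle : ∀ ω, ∀ y ∈ K ω, ‖p ω‖ ≤ ‖y‖ := by
    intro ω y hy
    rcases (norm_nonneg (p ω)).eq_or_lt with h | h
    · rw [← h]; exact norm_nonneg y
    · have := (hmin ω y hy).trans (real_inner_le_norm _ _)
      rw [sq] at this
      exact le_of_mul_le_mul_left this h
  have hnorm : Measurable fun ω => ‖p ω‖ := by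
    refine measurable_of_Iio fun r => ?_
    convert hK 0 r using 1
    ext ω
    constructor
    · intro h
      obtain ⟨y, hy, hy'⟩ := mem_closure_iff.1 (hp ω) _ Metric.isOpen_ball
        (mem_ball_zero_iff.2 h)
      exact ⟨y, hy', hy⟩
    · rintro ⟨y, hy, hyr⟩
      exact (hle ω y hy).trans_lt (mem_ball_zero_iff.1 hyr)
  have : Nonempty V := ⟨0⟩
  obtain ⟨Z, hZ⟩ := TopologicalSpace.exists_dense_seq V
  let A : ℕ → M → ℕ → Prop := fun n ω k =>
    (K ω ∩ Metric.ball (Z k) (1 / (n + 1))).Nonempty ∧ ‖Z k‖ < ‖p ω‖ + 1 / (n + 1)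
  have hA : ∀ n ω, ∃ k, A n ω k := by
    intro n ω
    have hε : (0 : ℝ) < 1 / (n + 1) := Nat.one_div_pos_of_nat
    obtain ⟨k, hk⟩ := hZ.exists_dist_lt (p ω) hε
    refine ⟨k, ?_, ?_⟩
    · obtain ⟨y, hy, hy'⟩ := mem_closure_iff.1 (hp ω) _ Metric.isOpen_ball hk
      exact ⟨y, hy', hy⟩
    · have := norm_sub_norm_le (Z k) (p ω)
      rw [← dist_eq_norm, dist_comm] at this
      linarith
  classical
  let g : ℕ → M → V := fun n ω => Z (Nat.find (hA n ω))
  have hg : ∀ n, Measurable (g n) := by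
    intro n
    refine (measurable_from_top (f := Z)).comp (measurable_find (hA n) fun k => ?_)
    exact (hK _ _).inter (measurableSet_lt measurable_const (hnorm.add_const _))
  refine measurable_of_tendsto_metrizable hg (tendsto_pi_nhds.2 fun ω => ?_)
  rw [tendsto_iff_dist_tendsto_zero]
  have hε : Filter.Tendsto (fun n : ℕ => 1 / ((n : ℝ) + 1)) Filter.atTop (nhds 0) :=
    tendsto_one_div_add_atTop_nhds_zero_nat
  -- The factor `2`: a point `y` of `K ω` lies within `1 / (n + 1)` of `g n ω`, whose norm exceeds
  -- `‖p ω‖` by less than `1 / (n + 1)`.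
  have hbound : Filter.Tendsto (fun n : ℕ => 1 / ((n : ℝ) + 1) +
      √((‖p ω‖ + 2 * (1 / ((n : ℝ) + 1))) ^ 2 - ‖p ω‖ ^ 2)) Filter.atTop (nhds 0) := by
    have := hε.add (((((hε.const_mul 2).const_add ‖p ω‖).pow 2).sub_const (‖p ω‖ ^ 2)).sqrt)
    simpa using this
  refine squeeze_zero (fun _ => dist_nonneg) (fun n => ?_) hbound
  obtain ⟨⟨y, hy, hyz⟩, hz⟩ := Nat.find_spec (hA n ω)
  change y ∈ Metric.ball (g n ω) _ at hyz
  change ‖g n ω‖ < _ at hz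
  rw [Metric.mem_ball] at hyz
  have hyn : ‖y‖ ≤ ‖p ω‖ + 2 * (1 / ((n : ℝ) + 1)) := by
    have := norm_sub_norm_le y (g n ω)
    rw [← dist_eq_norm] at this
    linarith
  have hyp : dist y (p ω) ≤ √((‖p ω‖ + 2 * (1 / ((n : ℝ) + 1))) ^ 2 - ‖p ω‖ ^ 2) := by
    refine Real.le_sqrt_of_sq_le ?_
    rw [dist_eq_norm, norm_sub_sq_real, real_inner_comm]
    have h1 := hmin ω y hy
    have h2 := pow_le_pow_left₀ (norm_nonneg y) hyn 2
    linarith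
  have := dist_triangle_left (g n ω) (p ω) y
  linarith

/-! ### Polar sets -/

section Polar

variable {E : Type*} [MeasurableSpace E] {ℛ : Set (ProbabilityMeasure E)}

theorem IsPolar.mono {M N : Set E} (hN : IsPolar ℛ N) (h : M ⊆ N) : IsPolar ℛ M := by
  obtain ⟨A, hA, hNA, h0⟩ := hN
  exact ⟨A, hA, h.trans hNA, h0⟩

theorem IsPolar.union {M N : Set E} (hM : IsPolar ℛ M) (hN : IsPolar ℛ N) :
    IsPolar ℛ (M ∪ N) := by
  obtain ⟨A, hA, hMA, hA0⟩ := hM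
  obtain ⟨B, hB, hNB, hB0⟩ := hN
  exact ⟨A ∪ B, hA.union hB, union_subset_union hMA hNB,
    fun P hP => measure_union_null (hA0 P hP) (hB0 P hP)⟩

theorem QuasiSurely.mono {p q : E → Prop} (hp : QuasiSurely ℛ p) (h : ∀ x, p x → q x) :
    QuasiSurely ℛ q :=
  IsPolar.mono hp fun _ hq hpx => hq (h _ hpx)

theorem QuasiSurely.and {p q : E → Prop} (hp : QuasiSurely ℛ p) (hq : QuasiSurely ℛ q) :
    QuasiSurely ℛ fun x => p x ∧ q x :=
  (IsPolar.union hp hq).mono fun _ h => not_and_or.1 h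

theorem QuasiSurely.of_forall {p : E → Prop} (h : ∀ x, p x) : QuasiSurely ℛ p :=
  ⟨∅, .empty, fun x hx => hx (h x), by simp⟩

theorem quasiSurely_congr {p q : E → Prop} (h : ∀ x, p x ↔ q x) :
    QuasiSurely ℛ p ↔ QuasiSurely ℛ q :=
  ⟨fun hp => hp.mono fun x => (h x).1, fun hq => hq.mono fun x => (h x).2⟩

end Polar

/-! ### Measurable strategies and the equivalences -/

theorem measurable_hist_snoc {Ω : ℕ → Type*} [∀ i, MeasurableSpace (Ω i)] (t : ℕ) :
    Measurable fun p : Hist Ω t × Ω t => Hist.snoc p.1 p.2 := by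
  refine measurable_pi_lambda _ fun i => ?_
  refine Fin.lastCases ?_ (fun j => ?_) i
  · simpa [Hist.snoc] using measurable_snd
  · simp only [Hist.snoc, Fin.snoc_castSucc]
    exact (measurable_pi_apply j).comp measurable_fst

/-- If the hitting sets of the quasi-sure support are universally measurable, then the states
with an instantaneous profit admit a universally measurable strategy that realizes it. -/
theorem exists_univMeasurable_instantaneousProfit {E F : Type*} [MeasurableSpace E]
    [MeasurableSpace F] {d : ℕ} {𝒬 : E → Set (ProbabilityMeasure F)}
    (h𝒬 : ∀ ω, (𝒬 ω).Nonempty) {Y : E → F → EuclideanSpace ℝ (Fin d)}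
    (hY : ∀ ω, Measurable (Y ω))
    (hhit : ∀ q r, MeasurableSet[universalSigma E]
      {ω | (convexHull ℝ (qsSupport (𝒬 ω) (Y ω)) ∩ Metric.ball q r).Nonempty}) :
    ∃ (θ : E → EuclideanSpace ℝ (Fin d)) (X : E → ℝ), UnivMeasurable θ ∧ UnivMeasurable X ∧
      (∀ ω, X ω ≤ 0) ∧ (∀ ω, X ω ∈ hedgePricesWith (𝒬 ω) (Y ω) (fun _ => 0) (θ ω)) ∧
      ∀ ω, X ω = 0 → AIPAt (𝒬 ω) (Y ω) := by
  obtain ⟨p, hpm, hp⟩ := @exists_measurable_minimal_norm E _ (universalSigma E) _ _ _ _ _ _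
    (fun ω => convexHull ℝ (qsSupport (𝒬 ω) (Y ω)))
    (fun ω => (qsSupport_nonempty (hY ω) (h𝒬 ω)).convexHull)
    (fun ω => convex_convexHull ℝ _) hhit
  have hX : Measurable fun v : EuclideanSpace ℝ (Fin d) => -(‖v‖ ^ 2 / ‖v‖ ^ 2) := by fun_prop
  have hθ : Measurable fun v : EuclideanSpace ℝ (Fin d) => (‖v‖ ^ 2)⁻¹ • v := by fun_prop
  -- As division by zero gives `0`, the claim is `-1` where `p ω ≠ 0`, while claim and strategy both
  -- vanish where `p ω = 0`.
  refine ⟨fun ω => (‖p ω‖ ^ 2)⁻¹ • p ω, fun ω => -(‖p ω‖ ^ 2 / ‖p ω‖ ^ 2),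
    hθ.comp hpm,
    hX.comp hpm,
    fun ω => neg_nonpos.2 (by positivity), fun ω => ?_, fun ω h => ?_⟩
  · refine quasiSurely_of_forall_mem_qsSupport
      (p := fun y => 0 ≤ -(‖p ω‖ ^ 2 / ‖p ω‖ ^ 2) + inner ℝ ((‖p ω‖ ^ 2)⁻¹ • p ω) y) (hY ω)
      fun y hy => ?_
    rw [real_inner_smul_left, div_eq_inv_mul, neg_add_eq_sub, sub_nonneg]
    exact mul_le_mul_of_nonneg_left ((hp ω).2 y (subset_convexHull ℝ _ hy)) (by positivity)
  · rw [aipAt_iff_zero_mem_closure_convexHull (hY ω)]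
    have h0 : p ω = 0 := by simpa using h
    exact h0 ▸ (hp ω).1

theorem mainTheorem7 {Ω : ℕ → Type*} [∀ i, TopologicalSpace (Ω i)] [∀ i, PolishSpace (Ω i)]
    [∀ i, MeasurableSpace (Ω i)] [∀ i, BorelSpace (Ω i)] (T d : ℕ)
    (S : (t : ℕ) → Hist Ω t → EuclideanSpace ℝ (Fin d))
    (hS_meas : ∀ t ≤ T, Measurable (S t))
    (hS_nonneg : ∀ t ≤ T, ∀ ω i, 0 ≤ S t ω i)
    (𝒬 : (t : ℕ) → Hist Ω t → Set (ProbabilityMeasure (Ω t)))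
    (h𝒬_nonempty : ∀ t < T, ∀ ω, (𝒬 t ω).Nonempty)
    (h𝒬_analytic : ∀ t, 1 ≤ t → t < T → AnalyticSet (priorGraph (𝒬 t)))
    (t : ℕ) (ht : t < T) :
    List.TFAE [
      OneStepAIP S 𝒬 t,
      IsFullMeasure (priors 𝒬 t) {ω | AIPAt (𝒬 t ω) (priceIncrement S t ω)},
      IsFullMeasure (priors 𝒬 t)
        {ω | hedgePrices (𝒬 t ω) (priceIncrement S t ω) (fun _ => 0) ∩ Iic 0 = {0}},
      QuasiSurely (priors 𝒬 t)
        (fun ω => hedgeCost (𝒬 t ω) (priceIncrement S t ω) (fun _ => 0) = 0),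
      ∀ X : Hist Ω t → ℝ, UnivMeasurable X →
        QuasiSurely (priors 𝒬 t) (fun ω => X ω ≤ 0) →
        IsFullMeasure (priors 𝒬 t)
          {ω | X ω ∈ hedgePrices (𝒬 t ω) (priceIncrement S t ω) (fun _ => 0)} →
        QuasiSurely (priors 𝒬 t) (fun ω => X ω = 0),
      QuasiSurely (priors 𝒬 t)
        (fun ω => 0 ∈ closure (convexHull ℝ (qsSupport (𝒬 t ω) (priceIncrement S t ω))))] ∧
    (QuasiSurely (priors 𝒬 t)
        (fun ω => 0 ∈ convexHull ℝ (qsSupport (𝒬 t ω) (priceIncrement S t ω))) →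
      OneStepAIP S 𝒬 t) ∧
    (QuasiSurely (priors 𝒬 t)
        (fun ω => IsClosed (convexHull ℝ (qsSupport (𝒬 t ω) (priceIncrement S t ω)))) →
      (OneStepAIP S 𝒬 t ↔
        QuasiSurely (priors 𝒬 t)
          (fun ω => 0 ∈ convexHull ℝ (qsSupport (𝒬 t ω) (priceIncrement S t ω))))) ∧
    AnalyticSet {ω | AIPAt (𝒬 t ω) (priceIncrement S t ω)} := by
  have hYm : Measurable fun p : Hist Ω t × Ω t => priceIncrement S t p.1 p.2 :=
    ((hS_meas (t + 1) ht).comp (measurable_hist_snoc t)).sub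
      ((hS_meas t ht.le).comp measurable_fst)
  have hY : ∀ ω, Measurable (priceIncrement S t ω) := fun ω =>
    hYm.comp measurable_prodMk_left
  have hhit : ∀ z r, AnalyticSet
      {ω | (qsSupport (𝒬 t ω) (priceIncrement S t ω) ∩ Metric.ball z r).Nonempty} := by
    intro z r
    simp_rw [qsSupport_inter_nonempty_iff (hY _) Metric.isOpen_ball]
    -- At time `0` there is one history, so every set of states is finite; the analytic graph is
    -- assumed only from time `1` on.
    rcases Nat.eq_zero_or_pos t with rfl | ht0
    · exact (Set.toFinite _).measurableSet.analyticSet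
    · exact analyticSet_exists_prior_ne_zero (h𝒬_analytic t ht0 ht) (hYm measurableSet_ball)
  have hconv := analyticSet_convexHull_inter_ball_nonempty hhit
  obtain ⟨θ, X, hθ, hX, hX0, hXθ, hXA⟩ := exists_univMeasurable_instantaneousProfit
    (h𝒬_nonempty t ht) hY fun q r => (hconv q r).measurableSet_universalSigma
  have haip := fun ω => aipAt_iff_zero_mem_closure_convexHull (ℛ := 𝒬 t ω) (hY ω)
  have h12 : OneStepAIP S 𝒬 t →
      IsFullMeasure (priors 𝒬 t) {ω | AIPAt (𝒬 t ω) (priceIncrement S t ω)} := fun h =>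
    (h θ hθ X hX (.of_forall hX0) (QuasiSurely.of_forall hXθ)).mono hXA
  have h53 : ∀ X : Hist Ω t → ℝ,
      IsFullMeasure (priors 𝒬 t) {ω | AIPAt (𝒬 t ω) (priceIncrement S t ω)} →
      QuasiSurely (priors 𝒬 t) (fun ω => X ω ≤ 0) →
      IsFullMeasure (priors 𝒬 t)
        {ω | X ω ∈ hedgePrices (𝒬 t ω) (priceIncrement S t ω) (fun _ => 0)} →
      QuasiSurely (priors 𝒬 t) (fun ω => X ω = 0) := fun X hF hX hXF =>
    ((QuasiSurely.and hF hX).and hXF).mono fun ω h =>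
      le_antisymm h.1.2 (aipAt_iff_forall_nonneg.1 h.1.1 _ h.2)
  have h62 : QuasiSurely (priors 𝒬 t)
      (fun ω => 0 ∈ closure (convexHull ℝ (qsSupport (𝒬 t ω) (priceIncrement S t ω)))) →
      OneStepAIP S 𝒬 t := fun h θ _ X _ hX hXF =>
    h53 X (h.mono fun ω => (haip ω).2) hX (hXF.mono fun ω hω hωθ => hω ⟨θ ω, hωθ⟩)
  refine ⟨?_, fun h => h62 (h.mono fun _ h => subset_closure h), fun hcl => ⟨fun h => ?_,
    fun h => h62 (h.mono fun _ h => subset_closure h)⟩, ?_⟩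
  · tfae_have 1 → 2 := h12
    tfae_have 2 ↔ 3 := quasiSurely_congr fun _ => aipAt_iff_inter_Iic_eq
    tfae_have 2 ↔ 4 := Iff.rfl
    tfae_have 2 ↔ 6 := quasiSurely_congr haip
    tfae_have 2 → 5 := fun h X _ => h53 X h
    tfae_have 5 → 1 := fun h θ _ X hX hX0 hXF =>
      h X hX hX0 (hXF.mono fun ω hω hωθ => hω ⟨θ ω, hωθ⟩)
    tfae_finish
  · refine (QuasiSurely.and hcl (h12 h)).mono fun ω hω => ?_
    have := (haip ω).1 hω.2
    rwa [hω.1.closure_eq] at this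
  -- Membership of `0` in the closure is tested on countably many balls, and analytic sets are
  -- stable under countable intersections.
  · have : {ω | AIPAt (𝒬 t ω) (priceIncrement S t ω)} = ⋂ n : ℕ, {ω |
        (convexHull ℝ (qsSupport (𝒬 t ω) (priceIncrement S t ω)) ∩
          Metric.ball 0 (1 / ((n : ℝ) + 1))).Nonempty} := by
      ext ω
      simp only [mem_iInter, mem_ofPred_eq, haip]
      constructor
      · intro h n
        obtain ⟨y, hy, hy'⟩ := mem_closure_iff.1 h _ Metric.isOpen_ball
          (Metric.mem_ball_self (Nat.one_div_pos_of_nat (n := n)))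
        exact ⟨y, hy', hy⟩
      · intro h
        refine Metric.mem_closure_iff.2 fun ε hε => ?_
        obtain ⟨n, hn⟩ := exists_nat_one_div_lt hε
        obtain ⟨y, hy, hyn⟩ := h n
        exact ⟨y, hy, by rw [dist_comm]; exact (Metric.mem_ball.1 hyn).trans hn⟩
    rw [this]
    exact .iInter fun n => hconv 0 _
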